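/- A hypergraph on a finite set $V$ is a nonempty set of subsets of $V$ (edges), each of cardinality at least $2$. A hypertree on $V$ is a hypergraph on $V$ that is connected and has no cycle, where a cycle is an alternating cyclic sequence $v_0,e_0,v_1,e_1,\dots,v_m,e_m,v_0$ with $m\ge 1$, distinct vertices $v_i$ and distinct edges $e_i$, each edge containing its two neighbours in the sequence. Its rank $\operatorname{Rg}(T)$ is its number of edges minus one. A cyclic hypertree is a hypertree together with, at every vertex, a cyclic order on the set of edges containing this vertex; it is flag-pointed if moreover a vertex and an edge containing this vertex are distinguished. Let $$\mathsf{HAC}(x)=\sum_{n\ge 2}\ \sum_{T} t^{\operatorname{Rg}(T)}\,\frac{x^n}{n!},\qquad \mathsf{HAC}^{pa}(x)=\sum_{n\ge 2}\ \sum_{T'} t^{\operatorname{Rg}(T')}\,\frac{x^n}{n!},$$ where $T$ runs over the cyclic hypertrees on $\{1,\dots,n\}$ and $T'$ over the flag-pointed cyclic hypertrees on $\{1,\dots,n\}$. Let $K$ be a field of characteristic $0$ and let $t\in K$, $t\neq 0$ (for instance $K=\mathbb{Q}(t)$ with $t$ an indeterminate). Among the pairs $(A,z)$ of formal power series in the indeterminate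 $B$ with coefficients in $K$, $z$ having zero constant term, the system $$A=-\frac1t\ln\!\left(\frac Bz\right),\qquad B=z-t\,z\,(\exp(z)-1)$$ (where $B/z$ is required to be a formal power series with constant term $1$) has exactly one solution, namely $$A=\partial_B\,\mathsf{HAC}(B),\qquad z=B+t\,\mathsf{HAC}^{pa}(B).$$ -/

import Mathlib

open scoped PowerSeries

namespace HypertreeSeries

/-- A hypergraph on the vertex set `V`: a nonempty set of subsets of `V` (the edges), each of
cardinality at least `2`. -/
def IsHypergraph {V : Type*} (E : Finset (Finset V)) : Prop :=
  E.Nonempty ∧ ∀ e ∈ E, 2 ≤ e.card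

/-- Two vertices are joined by a path, i.e. an alternating sequence of vertices and edges in which
every edge contains the two vertices adjacent to it. -/
def Joined {V : Type*} (E : Finset (Finset V)) : V → V → Prop :=
  Relation.ReflTransGen fun v w => ∃ e ∈ E, v ∈ e ∧ w ∈ e

/-- A (Berge) cycle `v₀, e₀, v₁, e₁, …, vₘ, eₘ, v₀` with `m + 1 ≥ 2` distinct vertices and as many
distinct edges, each edge containing the two vertices adjacent to it.
Indices are taken modulo `m + 1`. -/
def HasCycle {V : Type*} (E : Finset (Finset V)) : Prop :=
  ∃ (k : ℕ) (v : Fin (k + 2) → V) (e : Fin (k + 2) → Finset V),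
    Function.Injective v ∧ Function.Injective e ∧
      ∀ i, e i ∈ E ∧ v i ∈ e i ∧ v (i + 1) ∈ e i

/-- A hypertree on `V`: a connected hypergraph on `V` without cycles. -/
structure Hypertree (V : Type*) where
  edges : Finset (Finset V)
  isHypergraph : IsHypergraph edges
  connected : ∀ v w : V, Joined edges v w
  acyclic : ¬ HasCycle edges

/-- The edges of a hypertree that contain a given vertex. -/
abbrev Hypertree.EdgesAt {V : Type*} (T : Hypertree V) (v : V) : Type _ :=
  {e : Finset V // e ∈ T.edges ∧ v ∈ e}

/-- The rank of a hypertree is its number of edges minus one (there is at least one edge). -/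
def Hypertree.rank {V : Type*} (T : Hypertree V) : ℕ := T.edges.card - 1

/-- A cyclic order on a (finite) set, given by its successor map: a permutation with at most one
orbit, the elements following each other along the orbit. -/
abbrev CyclicOrder (α : Type*) : Type _ :=
  {σ : Equiv.Perm α // σ.IsCycleOn Set.univ}

/-- A cyclic hypertree: a hypertree with, at every vertex, a cyclic order on the set of edges
containing this vertex. -/
abbrev CyclicHypertree (V : Type*) : Type _ :=
  (T : Hypertree V) × ((v : V) → CyclicOrder (T.EdgesAt v))

/-- A flag-pointed cyclic hypertree: a cyclic hypertree with a flag, i.e. a distinguished vertex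
and a distinguished edge containing it. -/
abbrev FlagPointedCyclicHypertree (V : Type*) : Type _ :=
  (H : CyclicHypertree V) × ((v : V) × H.1.EdgesAt v)

instance {V : Type*} [Finite V] : Finite (Hypertree V) :=
  Finite.of_injective Hypertree.edges fun S T h => by
    cases S; cases T; simp_all

noncomputable instance {V : Type*} [Finite V] : Fintype (CyclicHypertree V) :=
  Fintype.ofFinite _

noncomputable instance {V : Type*} [Finite V] : Fintype (FlagPointedCyclicHypertree V) :=
  Fintype.ofFinite _

/-- The exponential generating series of cyclic hypertrees, each counted with weight
`t ^ rank`. (There is no hypertree on fewer than two vertices, so that the sum starts at `2`.) -/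
noncomputable def HAC {K : Type*} [Field K] (t : K) : K⟦X⟧ :=
  PowerSeries.mk fun n => (∑ H : CyclicHypertree (Fin n), t ^ H.1.rank) / (n.factorial : K)

/-- The exponential generating series of flag-pointed cyclic hypertrees, each counted with weight
`t ^ rank`. -/
noncomputable def HACpa {K : Type*} [Field K] (t : K) : K⟦X⟧ :=
  PowerSeries.mk fun n =>
    (∑ F : FlagPointedCyclicHypertree (Fin n), t ^ F.1.1.rank) / (n.factorial : K)

/-- The pair `(A, z)` of formal power series in the indeterminate `B` (which is `PowerSeries.X`)
solves the system `A = -(1/t) ln (B / z)`, `B = z - t z (exp z - 1)`.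
For the composite `exp z` to exist as a formal power series, `z` has no constant term;
the series `q` is the quotient `B / z`, and its logarithm exists because its constant term is `1`. -/
def IsSolution {K : Type*} [Field K] [CharZero K] (t : K) (A z : K⟦X⟧) : Prop :=
  PowerSeries.constantCoeff z = 0 ∧
  (∃ q : K⟦X⟧, q * z = PowerSeries.X ∧ PowerSeries.constantCoeff q = 1 ∧
    A = -(1 / t) • PowerSeries.logOf q) ∧
  PowerSeries.X = z - t • (z * ((PowerSeries.exp K).subst z - 1))

end HypertreeSeries

/-! Put `q = 1 - t (exp X - 1)`. The second equation says that `z` is the compositional inverse of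
`X * q`; hence `B / z` is `q` at `z`, and the solution exists and is unique. Lagrange inversion
gives its coefficients: `(n+1) [B^(n+1)] H(z) = [X^n] H' q^(-n-1)`, used with `H = X` for `z` and `H
= log q` for `A` (`coeff_succ_subst_of_subst_eq_X`). Expanding negative powers of `q` produces
binomials times numbers of surjections.

The same numbers count hypertrees. Root the tree at vertex `0`: each edge has one vertex nearest to
the root, its parent, and the others form a block. With labelled edges, a hypertree is a surjection
onto the labels together with a parent map in which every vertex leads back to the root
(`blockHypertree`, `exists_parents`). The weighted Cayley formula `sum_rooted_prod` replaces these
constrained parent maps on `k + 1` blocks by arbitrary maps from `k` points, keeping track of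
degrees. A vertex of degree `d` carries `(d - 1)!` cyclic orders, so summing over the maps gives a
rising factorial, which `k!`-normalisation turns into the binomials of the Lagrange side. -/

namespace PowerSeries

/-! ### Lagrange inversion and logarithms of power series -/

theorem coeff_pow_eq_zero_of_lt {R : Type*} [CommRing R] {a : R⟦X⟧}
    (ha : constantCoeff a = 0) {n j : ℕ} (h : n < j) : coeff n (a ^ j) = 0 :=
  (X_pow_dvd_iff.mp (pow_dvd_pow_of_dvd (X_dvd_iff.mpr ha) j)) n h

theorem coeff_subst_eq_sum_range {R : Type*} [CommRing R] {a : R⟦X⟧}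
    (ha : constantCoeff a = 0) (f : R⟦X⟧) {n N : ℕ} (h : n < N) :
    coeff n (f.subst a) = ∑ j ∈ Finset.range N, coeff j f * coeff n (a ^ j) := by
  rw [coeff_subst' (HasSubst.of_constantCoeff_zero' ha)]
  simp only [smul_eq_mul]
  refine finsum_eq_sum_of_support_subset _ fun j hj => ?_
  by_contra hjN
  have : N ≤ j := by simpa using hjN
  exact hj (by simp [coeff_pow_eq_zero_of_lt ha (h.trans_le this)])

section Lagrange

variable {K : Type*} [Field K] [CharZero K]

/-- The residue computation behind Lagrange inversion. -/
theorem coeff_derivative_X_mul_mul_pow {φ ψ : K⟦X⟧} (h : φ * ψ = 1) (hψ : constantCoeff ψ = 1)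
    (m : ℕ) : coeff m (derivative K (X * ψ) * φ ^ (m + 1)) = if m = 0 then 1 else 0 := by
  have hd : derivative K φ * ψ + φ * derivative K ψ = 0 := by
    have := congrArg (derivative K) h
    simp only [Derivation.leibniz, smul_eq_mul] at this
    rw [derivative_one] at this
    linear_combination this
  cases m with
  | zero =>
    have h0 : constantCoeff φ = 1 := by
      have := congrArg constantCoeff h
      simpa [hψ] using this
    simp [Derivation.leibniz, h0, hψ]
  | succ m =>
    -- As `φ² ψ' = -φ'`, the product is `F - X F' / (m + 1)` with `F = φ ^ (m + 1)`, whose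
    -- coefficient of degree `m + 1` vanishes.
    have key : derivative K (X * ψ) * φ ^ (m + 1 + 1)
        = φ ^ (m + 1) - C ((m + 1 : K)⁻¹) * (X * derivative K (φ ^ (m + 1))) := by
      have hc : C ((m + 1 : K)⁻¹) * ((m + 1 : ℕ) : K⟦X⟧) = 1 := by
        have : ((m + 1 : ℕ) : K⟦X⟧) = C ((m + 1 : ℕ) : K) := by simp
        rw [this, ← map_mul]
        rw [Nat.cast_succ, inv_mul_cancel₀ (Nat.cast_add_one_ne_zero m), map_one]
      rw [Derivation.leibniz, Derivation.leibniz_pow]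
      simp only [derivative_X, smul_eq_mul, nsmul_eq_mul, Nat.add_sub_cancel]
      linear_combination (X * φ ^ m * derivative K φ) * hc + φ ^ (m + 1) * h
        + X * φ ^ (m + 1) * hd - X * φ ^ m * derivative K φ * h
    rw [key, map_sub, coeff_C_mul, coeff_succ_X_mul, coeff_derivative]
    have : (m + 1 : K) ≠ 0 := Nat.cast_add_one_ne_zero m
    simp only [Nat.add_eq_zero_iff, one_ne_zero, and_false, if_false]
    field_simp
    ring

/-- Lagrange inversion, for the compositional inverse of `X * ψ`. -/
theorem lagrange_inversion {φ ψ h : K⟦X⟧} (hφ : φ * ψ = 1) (hψ : constantCoeff ψ = 1) (n : ℕ) :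
    (n + 1 : K) * coeff (n + 1) h
      = coeff n (derivative K (h.subst (X * ψ)) * φ ^ (n + 1)) := by
  have hg : constantCoeff (X * ψ) = 0 := by simp
  rw [derivative_subst (HasSubst.of_constantCoeff_zero' hg), mul_assoc, coeff_mul]
  have : ∀ p ∈ Finset.HasAntidiagonal.antidiagonal n, coeff p.1 ((derivative K h).subst (X * ψ))
      * coeff p.2 (derivative K (X * ψ) * φ ^ (n + 1))
      = ∑ j ∈ Finset.range (n + 1), coeff j (derivative K h) *
        (coeff p.1 ((X * ψ) ^ j) * coeff p.2 (derivative K (X * ψ) * φ ^ (n + 1))) := by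
    intro p hp
    rw [coeff_subst_eq_sum_range hg _ (N := n + 1) (by
      have := Finset.HasAntidiagonal.mem_antidiagonal.mp hp; omega), Finset.sum_mul]
    exact Finset.sum_congr rfl fun _ _ => by ring
  rw [Finset.sum_congr rfl this, Finset.sum_comm]
  have h2 : ∀ j ∈ Finset.range (n + 1), ∑ p ∈ Finset.HasAntidiagonal.antidiagonal n, coeff j (derivative K h) *
        (coeff p.1 ((X * ψ) ^ j) * coeff p.2 (derivative K (X * ψ) * φ ^ (n + 1)))
      = if j = n then coeff j (derivative K h) else 0 := by
    intro j hj
    rw [← Finset.mul_sum, ← coeff_mul]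
    obtain ⟨m, rfl⟩ := Nat.exists_eq_add_of_le (Finset.mem_range_succ_iff.mp hj)
    -- `φ ^ j` cancels `ψ ^ j`, so the residue computation applies and only `j = n` survives.
    have : (X * ψ) ^ j * (derivative K (X * ψ) * φ ^ (j + m + 1))
        = X ^ j * (derivative K (X * ψ) * φ ^ (m + 1)) := by
      have : (φ * ψ) ^ j = 1 := by rw [hφ, one_pow]
      rw [mul_pow] at this
      rw [mul_pow, show j + m + 1 = j + (m + 1) by ring, pow_add]
      linear_combination (X ^ j * (derivative K (X * ψ) * φ ^ (m + 1))) * this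
    rw [this, add_comm j m, coeff_X_pow_mul, coeff_derivative_X_mul_mul_pow hφ hψ]
    by_cases hm : m = 0 <;> simp [hm]
  rw [Finset.sum_congr rfl h2]
  simp [coeff_derivative, mul_comm]

theorem subst_logOf {f a : K⟦X⟧} (hf : constantCoeff f = 1) (ha : constantCoeff a = 0) :
    (logOf f).subst a = logOf (f.subst a) := by
  have ha' := HasSubst.of_constantCoeff_zero' ha
  have h1 : HasSubst (f - 1) := HasSubst.of_constantCoeff_zero' (by simp [hf])
  rw [logOf_eq, logOf_eq, subst_comp_subst_apply h1 ha', subst_sub ha']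
  congr 2
  simpa using subst_coe (R := K) (S := K) ha' (1 : Polynomial K)

theorem derivative_logOf_mul {f : K⟦X⟧} (hf : constantCoeff f = 1) :
    derivative K (logOf f) * f = derivative K f := by
  have h1 : HasSubst (f - 1) := HasSubst.of_constantCoeff_zero' (by simp [hf])
  have hone : subst (f - 1) (1 : K⟦X⟧) = 1 := by
    simpa using subst_coe (R := K) (S := K) h1 (1 : Polynomial K)
  have h2 : derivative K (log K) * (1 + X) = 1 := by
    rw [deriv_log]
    ext n
    cases n with
    | zero => simp [mul_add]
    | succ n => simp [mul_add, coeff_succ_mul_X, coeff_one, pow_succ]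
  have h3 := congrArg (subst (f - 1)) h2
  rw [subst_mul h1, subst_add h1, hone, subst_X h1] at h3
  rw [logOf_eq, derivative_subst h1, map_sub, derivative_one]
  linear_combination (derivative K f) * h3

omit [CharZero K] in
/-- The expansion of the negative powers of `1 - u`. -/
theorem coeff_pow_of_mul_one_sub_eq_one {φ u : K⟦X⟧} (hu : constantCoeff u = 0)
    (h : φ * (1 - u) = 1) (d : ℕ) {n N : ℕ} (hN : n < N) :
    coeff n (φ ^ (d + 1))
      = ∑ j ∈ Finset.range N, ((d + j).choose d : K) * coeff n (u ^ j) := by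
  have hu' := HasSubst.of_constantCoeff_zero' hu
  have hone : subst u (1 : K⟦X⟧) = 1 := by
    simpa using subst_coe (R := K) (S := K) hu' (1 : Polynomial K)
  have h1 := congrArg (subst u) (mk_add_choose_mul_one_sub_pow_eq_one K d)
  rw [subst_mul hu', subst_pow hu', subst_sub hu', hone, subst_X hu'] at h1
  have h2 : φ ^ (d + 1) * (1 - u) ^ (d + 1) = 1 := by rw [← mul_pow, h, one_pow]
  have h3 : φ ^ (d + 1) = subst u (mk fun n ↦ ((d + n).choose d : K)) := by
    calc φ ^ (d + 1) = (subst u (mk fun n ↦ ((d + n).choose d : K)) * (1 - u) ^ (d + 1)) *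
          φ ^ (d + 1) := by rw [h1, one_mul]
      _ = _ := by rw [mul_assoc, mul_comm ((1 - u) ^ (d + 1)), h2, mul_one]
  rw [h3, coeff_subst_eq_sum_range hu _ hN]
  simp

end Lagrange

end PowerSeries

/-! ### Counting surjections -/

namespace HypertreeSeries

open Finset

/-- The number of maps from an `m`-element set onto a `k`-element set. -/
def surjCount (m k : ℕ) : ℕ := Fintype.card {g : Fin m → Fin k // Function.Surjective g}

theorem card_filter_image_eq {m k : ℕ} (S : Finset (Fin k)) :
    (univ.filter fun g : Fin m → Fin k => univ.image g = S).card = surjCount m S.card := by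
  classical
  rw [surjCount, ← Fintype.card_coe]
  let e := S.equivFin
  refine Fintype.card_congr
    { toFun := fun g => ⟨fun i => e ⟨g.1 i, ?_⟩, ?_⟩
      invFun := fun g => ⟨fun i => (e.symm (g.1 i)).1, ?_⟩
      left_inv := fun g => by simp
      right_inv := fun g => by simp }
  · have := (mem_filter.mp g.2).2
    exact this.subset (mem_image_of_mem _ (mem_univ i))
  · intro b
    have h := (mem_filter.mp g.2).2
    have hb : (e.symm b).1 ∈ univ.image g.1 := by rw [h]; exact (e.symm b).2
    obtain ⟨i, -, hi⟩ := mem_image.mp hb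
    exact ⟨i, by simp [hi]⟩
  · refine mem_filter.mpr ⟨mem_univ _, ?_⟩
    ext x
    simp only [mem_image, mem_univ, true_and]
    refine ⟨?_, fun hx => ?_⟩
    · rintro ⟨i, rfl⟩; exact (e.symm _).2
    · obtain ⟨i, hi⟩ := g.2 (e ⟨x, hx⟩)
      exact ⟨i, by simp [hi]⟩

theorem sum_choose_mul_surjCount (m k : ℕ) :
    ∑ j ∈ range (k + 1), k.choose j * surjCount m j = k ^ m := by
  classical
  have h1 : k ^ m = ∑ S ∈ (univ : Finset (Fin k)).powerset, surjCount m S.card := by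
    have : k ^ m = (univ : Finset (Fin m → Fin k)).card := by simp
    rw [this, card_eq_sum_card_fiberwise (f := fun g => univ.image g)
      (t := (univ : Finset (Fin k)).powerset) (fun g _ => by simp)]
    exact sum_congr rfl fun S _ => card_filter_image_eq S
  rw [h1, sum_powerset_apply_card (fun j => surjCount m j)]
  simp

/-- Both sides solve the triangular system `∑ j, C(k, j) a j = k ^ m`: the left by sorting maps by
image, the right by expanding `exp(kX) = ((exp X - 1) + 1) ^ k`. -/
theorem surjCount_eq_coeff (K : Type*) [Field K] [CharZero K] (m k : ℕ) :
    (surjCount m k : K) = m.factorial * PowerSeries.coeff m ((PowerSeries.exp K - 1) ^ k) := by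
  induction k using Nat.strong_induction_on with
  | _ k ih =>
    have h1 : (∑ j ∈ range (k + 1), (k.choose j : K) * surjCount m j) = (k : K) ^ m := by
      exact_mod_cast congrArg (Nat.cast : ℕ → K) (sum_choose_mul_surjCount m k)
    have h2 : (∑ j ∈ range (k + 1), (k.choose j : K) *
        (m.factorial * PowerSeries.coeff m ((PowerSeries.exp K - 1) ^ j))) = (k : K) ^ m := by
      have h3 := PowerSeries.exp_pow_eq_rescale_exp (A := K) k
      rw [show PowerSeries.exp K = (PowerSeries.exp K - 1) + 1 by ring, add_pow,
        sub_add_cancel] at h3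
      have h4 := congrArg (PowerSeries.coeff m) h3
      simp only [one_pow, mul_one, map_sum, PowerSeries.coeff_rescale, PowerSeries.coeff_exp] at h4
      have hm : (m.factorial : K) ≠ 0 := by exact_mod_cast m.factorial_ne_zero
      have h5 : (k : K) ^ m = m.factorial * ((k : K) ^ m * (algebraMap ℚ K) (1 / m.factorial)) := by
        simp; field_simp
      rw [h5, ← h4, mul_sum]
      refine sum_congr rfl fun j _ => ?_
      rw [mul_comm (_ ^ j), ← map_natCast (PowerSeries.C (R := K)), PowerSeries.coeff_C_mul]
      ring
    rw [sum_range_succ] at h1 h2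
    rw [sum_congr rfl fun j hj => by rw [ih j (mem_range.mp hj)]] at h1
    have h6 := h1.trans h2.symm
    simpa using h6

theorem surjCount_eq_zero_of_lt {m k : ℕ} (h : m < k) : surjCount m k = 0 := by
  rw [surjCount, Fintype.card_eq_zero_iff]
  refine ⟨fun g => ?_⟩
  have := Fintype.card_le_of_surjective g.1 g.2
  simp at this
  omega

end HypertreeSeries

/-! ### Rooted parent maps and the weighted Cayley formula -/

namespace HypertreeSeries

open Finset

/-- The vertex `v` is at the root (its block is `none`) or its ancestors lead there: the parent of
every vertex of the block `b` is `f b`. -/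
inductive Rooted {V B : Type*} (β : V → Option B) (f : B → V) : V → Prop
  | root {v : V} (h : β v = none) : Rooted β f v
  | step {v : V} {b : B} (h : β v = some b) (hf : Rooted β f (f b)) : Rooted β f v

theorem rooted_iff_of_eq {V B : Type*} {β : V → Option B} {f : B → V} {v w : V}
    (h : β v = β w) : Rooted β f v ↔ Rooted β f w := by
  constructor <;> rintro (h' | ⟨h', hf⟩)
  · exact .root (h ▸ h')
  · exact .step (h ▸ h') hf
  · exact .root (h.symm ▸ h')
  · exact .step (h.symm ▸ h') hf

/-- The block map after the block `none` has been merged into that of `v₀`. -/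
def mergeBlock {V B : Type*} (β : V → Option (Option B)) (v₀ : V) (v : V) : Option B :=
  (β v).elim none fun b => b.elim ((β v₀).elim none id) some

/-- Once the parent `f none` of one block is fixed outside that block, its vertices reach the root
exactly when `f none` does, so the block can be absorbed into that of its parent. This is the
induction step of the Cayley formula. -/
theorem rooted_cons_iff {V B : Type*} {β : V → Option (Option B)} {f : Option B → V} :
    (∀ v, Rooted β f v) ↔ β (f none) ≠ some none ∧
      ∀ v, Rooted (mergeBlock β (f none)) (fun b => f (some b)) v := by
  constructor
  · intro h
    have h0 : β (f none) ≠ some none := by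
      intro h0
      have : ∀ v, Rooted β f v → β v ≠ some none := by
        intro v hv
        induction hv with
        | root h => simp [h]
        | @step v b h _ ih =>
          rintro h'
          obtain rfl : b = none := by simpa [h] using h'
          exact ih h0
      exact this _ (h _) h0
    refine ⟨h0, fun v => ?_⟩
    induction h v with
    | root h => exact .root (by simp [mergeBlock, h])
    | @step v b h _ ih =>
      cases b with
      | none =>
        refine (rooted_iff_of_eq ?_).mp ih
        simp only [mergeBlock, h]
        rcases h1 : β (f none) with _ | _ | b
        · simp
        · exact absurd h1 h0
        · simp
      | some b => exact .step (b := b) (by simp [mergeBlock, h]) ih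
  · rintro ⟨h0, h⟩ v
    induction h v with
    | @root v h =>
      rcases h1 : β v with _ | _ | b
      · exact .root h1
      · refine .step h1 (.root ?_)
        rcases h2 : β (f none) with _ | _ | b
        · rfl
        · exact absurd h2 h0
        · simp [mergeBlock, h1, h2] at h
      · simp [mergeBlock, h1] at h
    | @step v b h _ ih =>
      rcases h1 : β v with _ | _ | b'
      · simp [mergeBlock, h1] at h
      · refine .step h1 ?_
        rcases h2 : β (f none) with _ | _ | b'
        · simp [mergeBlock, h1, h2] at h
        · exact absurd h2 h0
        · obtain rfl : b' = b := by simpa [mergeBlock, h1, h2] using h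
          exact .step h2 ih
      · obtain rfl : b' = b := by simpa [mergeBlock, h1] using h
        exact .step h1 ih

theorem rooted_congr {V B B' : Type*} {β : V → Option B} {f : B → V} (e : B ≃ B') {v : V} :
    Rooted (fun v => (β v).map e) (fun b => f (e.symm b)) v ↔ Rooted β f v := by
  constructor
  · intro h
    induction h with
    | root h => exact .root (by simpa using h)
    | @step v b h _ ih =>
      obtain ⟨c, hc, rfl⟩ := Option.map_eq_some_iff.mp h
      exact .step hc (by simpa using ih)
  · intro h
    induction h with
    | root h => exact .root (by simp [h])
    | @step v b h _ ih => exact .step (b := e b) (by simp [h]) (by simpa using ih)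

/-- A block containing its own parent would need an infinite descent. Applied to `v = f b`, it shows
that a parent never lies in its own block. -/
theorem Rooted.ne_some {V B : Type*} {β : V → Option B} {f : B → V} {b : B}
    (hb : β (f b) = some b) {v : V} (hv : Rooted β f v) : β v ≠ some b := by
  induction hv with
  | root h => simp [h]
  | @step v c h _ ih =>
    rintro h'
    obtain rfl : c = b := by simpa [h] using h'
    exact ih hb

open Classical in
/-- The weighted Cayley formula, for maps from the blocks of a partition to its elements. -/
theorem sum_rooted_prod {V : Type*} [Fintype V] {R : Type*} [CommRing R] (x : V → R)
    {B : Type} [Fintype B] (β : V → Option B) {k : ℕ} (hk : Fintype.card B = k + 1) :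
    ∑ f : B → V with ∀ v, Rooted β f v, ∏ b, x (f b)
      = (∑ v with β v = none, x v) * (∑ v, x v) ^ k := by
  induction k generalizing B with
  | zero =>
    obtain ⟨b₀, hb₀⟩ := Fintype.card_eq_one_iff.mp hk
    have : Unique B := ⟨⟨b₀⟩, hb₀⟩
    rw [pow_zero, mul_one]
    refine sum_bij (fun f _ => f b₀) ?_ ?_ ?_ ?_
    · intro f hf
      simp only [mem_filter, mem_univ, true_and] at hf ⊢
      rcases h : β (f b₀) with _ | b
      · rfl
      · rw [hb₀ b] at h
        exact absurd h ((hf (f b₀)).ne_some h)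
    · intro f _ g _ h
      funext b
      rw [hb₀ b]; exact h
    · intro v hv
      refine ⟨fun _ => v, ?_, rfl⟩
      simp only [mem_filter, mem_univ, true_and] at hv ⊢
      intro w
      cases h : β w with
      | none => exact .root h
      | some b => exact .step h (.root hv)
    · intro f _
      rw [Fintype.prod_unique]
      congr 2
      exact hb₀ _
  | succ k ih =>
    obtain ⟨e⟩ : Nonempty (B ≃ Option (Fin (k + 1))) := ⟨Fintype.equivOfCardEq (by simp [hk])⟩
    set γ : V → Option (Option (Fin (k + 1))) := fun v => (β v).map e with hγ
    have h1 : ∑ f : B → V with ∀ v, Rooted β f v, ∏ b, x (f b)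
        = ∑ f : Option (Fin (k + 1)) → V with ∀ v, Rooted γ f v, ∏ b, x (f b) := by
      rw [sum_filter, sum_filter]
      refine Fintype.sum_equiv (e.arrowCongr (Equiv.refl V)) _ _ fun f => ?_
      have : (e.arrowCongr (Equiv.refl V)) f = fun b => f (e.symm b) := rfl
      rw [this]
      simp only [hγ, rooted_congr]
      congr 1
      exact (Equiv.prod_comp e.symm fun b => x (f b)).symm
    have h2 : ∑ v with β v = none, x v = ∑ v with γ v = none, x v := by simp [hγ]
    rw [h1, h2]
    clear_value γ
    clear h1 h2 hγ
    -- Sum first over the parent `v₀` of the block `none`, then apply induction to the merged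
    -- blocks.
    have h3 : ∑ f : Option (Fin (k + 1)) → V with ∀ v, Rooted γ f v, ∏ b, x (f b)
        = ∑ v₀ with γ v₀ ≠ some none, x v₀ *
          ((∑ v with mergeBlock γ v₀ v = none, x v) * (∑ v, x v) ^ k) := by
      rw [sum_filter, sum_filter,
        ← (Equiv.piOptionEquivProd (β := fun _ : Option (Fin (k + 1)) => V)).symm.sum_comp,
        Fintype.sum_prod_type]
      refine sum_congr rfl fun v₀ _ => ?_
      have h4 : ∀ f : Fin (k + 1) → V,
          (Equiv.piOptionEquivProd (β := fun _ : Option (Fin (k + 1)) => V)).symm (v₀, f)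
            = fun b => b.elim v₀ f := by
        intro f; funext b; cases b <;> rfl
      simp only [h4, rooted_cons_iff, Option.elim_none, Option.elim_some, Fintype.prod_option]
      split_ifs with h
      · rw [← ih (mergeBlock γ v₀) (by simp), mul_sum, sum_filter]
        exact sum_congr (by ext; simp) fun f _ => by simp [h]
      · simp [h]
    rw [h3]
    -- Merging enlarges the root block only if `v₀` lies in it.
    have h5 : ∀ v₀ : V, γ v₀ ≠ some none → ∑ v with mergeBlock γ v₀ v = none, x v
        = (∑ v with γ v = none, x v) +
          if γ v₀ = none then ∑ v with γ v = some none, x v else 0 := by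
      intro v₀ h0
      simp only [sum_filter]
      by_cases h : γ v₀ = none
      · simp only [h, if_true]
        rw [← sum_add_distrib]
        refine sum_congr rfl fun v _ => ?_
        rcases hv : γ v with _ | _ | b <;> simp [mergeBlock, hv, h]
      · simp only [h, if_false, add_zero]
        refine sum_congr rfl fun v _ => ?_
        rcases hw : γ v₀ with _ | _ | b
        · exact absurd hw h
        · exact absurd hw h0
        · rcases hv : γ v with _ | _ | b <;> simp [mergeBlock, hv, hw]
    have h6 : ∑ v, x v = ∑ v with γ v = some none, x v + ∑ v with γ v ≠ some none, x v :=
      (sum_filter_add_sum_filter_not _ _ _).symm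
    have h7 : ∑ v₀ with γ v₀ ≠ some none, x v₀ *
          (if γ v₀ = none then ∑ v with γ v = some none, x v else 0)
        = (∑ v with γ v = none, x v) * ∑ v with γ v = some none, x v := by
      rw [sum_filter, sum_filter (fun v => γ v = none), sum_mul]
      refine sum_congr rfl fun v _ => ?_
      rcases hv : γ v with _ | _ | b <;> simp
    rw [sum_congr rfl fun v₀ hv₀ => by rw [h5 v₀ (mem_filter.mp hv₀).2]]
    simp only [← mul_assoc, mul_add, add_mul, sum_add_distrib, ← sum_mul]
    rw [h7, pow_succ']
    -- With `R`, `N`, `S` the weights of the root block, of the block `none` and of all vertices: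
    -- `(S - N) R + R N = R S`.
    linear_combination (-(∑ v with γ v = none, x v) * (∑ v, x v) ^ k) * h6

/-- The sizes of the fibres of a map. -/
def fiberCard {V : Type*} [DecidableEq V] {B : Type*} [Fintype B] (f : B → V) (v : V) : ℕ :=
  (univ.filter fun b => f b = v).card

open Classical in
/-- The weighted Cayley formula, in terms of the fibre sizes. -/
theorem sum_rooted_fiberCard {V : Type*} [Fintype V] {R : Type*} [CommRing R]
    (W : (V → ℕ) → R) {B : Type} [Fintype B] (β : V → Option B) {k : ℕ}
    (hk : Fintype.card B = k + 1) {r : V} (hr : ∀ v, β v = none ↔ v = r) :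
    ∑ f : B → V with ∀ v, Rooted β f v, W (fiberCard f)
      = ∑ h : Fin k → V, W (fun v => fiberCard h v + if v = r then 1 else 0) := by
  -- Applying the linear form that sends each monomial to `W` of its exponents carries the
  -- polynomial identity over to an arbitrary weight.
  let L : MvPolynomial V R →ₗ[R] R :=
    (MvPolynomial.basisMonomials V R).constr R fun s => W s
  have hL : ∀ s : V →₀ ℕ, L (MvPolynomial.monomial s 1) = W s := fun s => by
    have := (MvPolynomial.basisMonomials V R).constr_basis R (fun s => W s) s
    simpa using this
  have hmon : ∀ {C : Type} [Fintype C] (f : C → V),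
      ∏ b, (MvPolynomial.X (f b) : MvPolynomial V R)
        = MvPolynomial.monomial (∑ b, Finsupp.single (f b) 1) 1 := by
    intro C _ f
    rw [MvPolynomial.monomial_sum_one]
    rfl
  have hcard : ∀ {C : Type} [Fintype C] (f : C → V),
      ((∑ b, Finsupp.single (f b) 1 : V →₀ ℕ) : V → ℕ) = fiberCard f := by
    intro C _ f
    funext v
    rw [fiberCard, Finsupp.finsetSum_apply, card_filter]
    exact sum_congr rfl fun b _ => Finsupp.single_apply
  have key := congrArg L (sum_rooted_prod (fun v => (MvPolynomial.X v : MvPolynomial V R)) β hk)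
  rw [map_sum] at key
  rw [sum_congr rfl fun f _ => by rw [← hcard f, ← hL, ← hmon f], key]
  have hroot : ∑ v with β v = none, (MvPolynomial.X v : MvPolynomial V R) = MvPolynomial.X r := by
    simp [hr, sum_filter]
  have hpow : (∑ v, (MvPolynomial.X v : MvPolynomial V R)) ^ k
      = ∑ h : Fin k → V, ∏ i, MvPolynomial.X (h i) := by
    rw [← Fintype.prod_sum]; simp
  rw [hroot, hpow, mul_sum, map_sum]
  refine sum_congr rfl fun h _ => ?_
  rw [hmon, MvPolynomial.X, MvPolynomial.monomial_mul, one_mul, hL]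
  congr 1
  funext v
  rw [Finsupp.add_apply, hcard, Finsupp.single_apply, add_comm]
  simp [eq_comm]

/-- Maps into an `n`-element set, with a linear order on each fibre, are counted by the rising
factorials. -/
theorem sum_prod_factorial_fiberCard {V : Type*} [Fintype V] [DecidableEq V] (k : ℕ) :
    ∑ h : Fin k → V, ∏ v, (fiberCard h v).factorial = (Fintype.card V).ascFactorial k := by
  induction k with
  | zero => simp [fiberCard]
  | succ k ih =>
    rw [← (Fin.consEquiv fun _ => V).sum_comp, Fintype.sum_prod_type, sum_comm,
      Nat.ascFactorial_succ, ← ih, mul_sum]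
    refine sum_congr rfl fun h _ => ?_
    have h1 : ∀ v w, fiberCard ((Fin.consEquiv fun _ => V) (v, h)) w
        = fiberCard h w + if v = w then 1 else 0 := by
      intro v w
      simp only [fiberCard, card_filter, Fin.sum_univ_succ, Fin.consEquiv_apply, Fin.cons_zero,
        Fin.cons_succ]
      rw [add_comm]
    -- A new element sent to `v` has `fiberCard h v + 1` positions in the order there; over all `v`
    -- this totals `|V| + k`.
    have h2 : ∀ v, ∏ w, (fiberCard ((Fin.consEquiv fun _ => V) (v, h)) w).factorial
        = (fiberCard h v + 1) * ∏ w, (fiberCard h w).factorial := by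
      intro v
      rw [← mul_prod_erase univ _ (mem_univ v),
        ← mul_prod_erase univ (fun w => (fiberCard h w).factorial) (mem_univ v), ← mul_assoc]
      congr 1
      · rw [h1, if_pos rfl, Nat.factorial_succ]
      · refine prod_congr rfl fun w hw => ?_
        rw [h1, if_neg (ne_of_mem_erase hw).symm, add_zero]
    rw [sum_congr rfl fun v _ => h2 v, ← sum_mul, sum_add_distrib]
    congr 1
    simp only [sum_const, card_univ, smul_eq_mul, mul_one]
    rw [add_comm]
    congr 1
    simpa [fiberCard] using (card_eq_sum_card_fiberwise (f := h) (s := univ) (t := univ)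
      (fun _ _ => mem_univ _)).symm

end HypertreeSeries

namespace HypertreeSeries

open Finset

/-! ### Cycles and removal of edges -/

section Joined

variable {V : Type*} {E : Finset (Finset V)} {u v w : V}

theorem Joined.symm (h : Joined E v w) : Joined E w v := by
  induction h with
  | refl => exact .refl
  | tail _ h ih =>
    obtain ⟨e, he, h1, h2⟩ := h
    exact .head ⟨e, he, h2, h1⟩ ih

theorem Joined.trans (h : Joined E u v) (h' : Joined E v w) : Joined E u w :=
  Relation.ReflTransGen.trans h h'

theorem Joined.mono {E' : Finset (Finset V)} (hE : E ⊆ E') (h : Joined E v w) : Joined E' v w :=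
  Relation.ReflTransGen.mono (fun _ _ ⟨e, he, h⟩ => ⟨e, hE he, h⟩) _ _ h

theorem Joined.of_mem {e : Finset V} (he : e ∈ E) (hv : v ∈ e) (hw : w ∈ e) : Joined E v w :=
  .single ⟨e, he, hv, hw⟩

variable [DecidableEq V]

/-- Follow the path until it first uses `e`. -/
theorem Joined.erase_or (e : Finset V) (h : Joined E v w) :
    Joined (E.erase e) v w ∨ ∃ u ∈ e, Joined (E.erase e) v u := by
  induction h with
  | refl => exact .inl .refl
  | @tail a b _ h ih =>
    rcases ih with ih | ih
    · obtain ⟨e', he', ha, hb⟩ := h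
      by_cases hee : e' = e
      · exact .inr ⟨a, hee ▸ ha, ih⟩
      · exact .inl (ih.trans (.of_mem (mem_erase.mpr ⟨hee, he'⟩) ha hb))
    · exact .inr ih

/-- A hypergraph has a cycle if and only if two vertices of an edge remain joined after the removal
of this edge. -/
theorem hasCycle_iff : HasCycle E ↔
    ∃ e ∈ E, ∃ v ∈ e, ∃ w ∈ e, v ≠ w ∧ Joined (E.erase e) v w := by
  constructor
  · rintro ⟨k, v, e, hv, he, h⟩
    refine ⟨e 0, (h 0).1, v 1, by simpa using (h 0).2.2, v 0, (h 0).2.1, hv.ne (by simp), ?_⟩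
    -- Go round the cycle from `v 1` back to `v 0`, avoiding `e 0`.
    have key : ∀ j : ℕ, j ≤ k + 1 →
        Joined (E.erase (e 0)) (v 1) (v (Fin.ofNat (k + 2) (j + 1))) := by
      intro j
      induction j with
      | zero => exact fun _ => .refl
      | succ j ih =>
        intro hj
        refine (ih (by omega)).trans (.of_mem (e := e (Fin.ofNat (k + 2) (j + 1))) ?_
          (h _).2.1 ?_)
        · refine mem_erase.mpr ⟨he.ne fun h0 => ?_, (h _).1⟩
          have := congrArg Fin.val h0
          rw [Fin.val_ofNat, Nat.mod_eq_of_lt (by omega)] at this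
          simp at this
        · rw [show Fin.ofNat (k + 2) (j + 1 + 1) = Fin.ofNat (k + 2) (j + 1) + 1 from
            Fin.ext (by simp [Fin.val_add])]
          exact (h _).2.2
    have := key (k + 1) le_rfl
    rwa [show Fin.ofNat (k + 2) (k + 1 + 1) = 0 from Fin.ext (by simp)] at this
  · rintro ⟨e, he, v, hv, w, hw, hvw, hj⟩
    -- A shortest path in this graph, closed up by `e`, is the required cycle.
    let G : SimpleGraph V :=
      { Adj := fun a b => a ≠ b ∧ ∃ e' ∈ E.erase e, a ∈ e' ∧ b ∈ e'
        symm := ⟨fun a b ⟨h, e', h1, h2, h3⟩ => ⟨h.symm, e', h1, h3, h2⟩⟩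
        loopless := ⟨fun a h => h.1 rfl⟩ }
    have hdist : ∀ {a b : V}, (∃ e' ∈ E.erase e, a ∈ e' ∧ b ∈ e') → ∃ q : G.Walk a b,
        q.length ≤ 1 := by
      intro a b h
      by_cases hab : a = b
      · subst hab; exact ⟨.nil, by simp⟩
      · exact ⟨.cons (show G.Adj a b from ⟨hab, h⟩) .nil, by simp⟩
    have hreach : G.Reachable v w := by
      clear hvw hw
      induction hj with
      | refl => exact .refl _
      | tail _ h ih => exact ih.trans ⟨(hdist h).choose⟩
    obtain ⟨p, hp⟩ := hreach.exists_walk_length_eq_dist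
    have hpath := p.isPath_of_length_eq_dist hp
    obtain ⟨k, hk⟩ : ∃ k, p.length = k + 1 := by
      refine Nat.exists_eq_succ_of_ne_zero fun h0 => hvw ?_
      exact SimpleGraph.Walk.eq_of_length_eq_zero h0
    have hstep : ∀ i : ℕ, ∃ e', i < k + 1 →
        e' ∈ E.erase e ∧ p.getVert i ∈ e' ∧ p.getVert (i + 1) ∈ e' := by
      intro i
      by_cases hi : i < k + 1
      · obtain ⟨-, e', h⟩ := p.adj_getVert_succ (i := i) (by omega)
        exact ⟨e', fun _ => h⟩
      · exact ⟨∅, fun h => absurd h hi⟩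
    choose d hd using hstep
    -- A repeated edge would give a shortcut from vertex `i` to vertex `j + 1`.
    have hne : ∀ i j, i < j → j < k + 1 → d i ≠ d j := by
      intro i j hij hjk heq
      obtain ⟨q, hq⟩ := hdist (a := p.getVert i) (b := p.getVert (j + 1))
        ⟨d i, (hd i (by omega)).1, (hd i (by omega)).2.1, heq ▸ (hd j hjk).2.2⟩
      have h1 := SimpleGraph.dist_le ((p.take i).append (q.append (p.drop (j + 1))))
      simp only [SimpleGraph.Walk.length_append, SimpleGraph.Walk.take_length,
        SimpleGraph.Walk.drop_length] at h1
      omega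
    have hlt : ∀ i : Fin (k + 2), i ≠ Fin.last _ → i.1 < k + 1 := fun i hi => by
      have := Fin.val_lt_last hi; simpa using this
    refine ⟨k, fun i => p.getVert i, fun i => if i = Fin.last _ then e else d i, ?_, ?_, ?_⟩
    · intro i j hij
      exact Fin.ext (hpath.getVert_injOn (by simp; omega) (by simp; omega) hij)
    · intro i j hij
      by_cases hi : i = Fin.last _ <;> by_cases hj : j = Fin.last _ <;>
        simp only [hi, hj, if_true, if_false] at hij
      · rw [hi, hj]
      · exact absurd hij.symm (ne_of_mem_erase (hd j (hlt j hj)).1)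
      · exact absurd hij (ne_of_mem_erase (hd i (hlt i hi)).1)
      · rcases lt_trichotomy i.1 j.1 with h | h | h
        · exact absurd hij (hne _ _ h (hlt j hj))
        · exact Fin.ext h
        · exact absurd hij.symm (hne _ _ h (hlt i hi))
    · intro i
      by_cases hi : i = Fin.last _
      · subst hi
        simp only [if_true, Fin.last_add_one, Fin.val_last]
        refine ⟨he, ?_, by simpa using hv⟩
        rw [← hk, SimpleGraph.Walk.getVert_length]
        exact hw
      · simp only [hi, if_false]
        obtain ⟨h1, h2, h3⟩ := hd i (hlt i hi)
        refine ⟨mem_of_mem_erase h1, h2, ?_⟩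
        rwa [Fin.val_add_one_of_lt (Fin.lt_last_iff_ne_last.mpr hi)]

end Joined

/-! ### Hypertrees as blocks with parents -/

section Parents

variable {V B : Type*} [Fintype V] [DecidableEq V] [DecidableEq B]

/-- The edge made of the block `b` and its parent. -/
def blockEdge (β : V → Option B) (f : B → V) (b : B) : Finset V :=
  insert (f b) (univ.filter fun v => β v = some b)

variable {β : V → Option B} {f : B → V} {r : V}

theorem mem_blockEdge {b : B} {v : V} : v ∈ blockEdge β f b ↔ v = f b ∨ β v = some b := by
  simp [blockEdge]

omit [Fintype V] [DecidableEq V] [DecidableEq B] in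
theorem wellFounded_parent (R : ∀ v, Rooted β f v) :
    WellFounded fun u v => ∃ b, β v = some b ∧ u = f b := by
  refine ⟨fun v => ?_⟩
  induction R v with
  | root h => exact ⟨_, fun u ⟨b, hb, _⟩ => by simp [h] at hb⟩
  | @step v b h _ ih =>
    refine ⟨_, fun u ⟨b', hb, hu⟩ => ?_⟩
    obtain rfl : b = b' := by simpa [h] using hb
    exact hu ▸ ih

/-- If two edges coincide, a vertex of each block is the parent of the other block, contradicting
well-foundedness. -/
theorem blockEdge_injective (R : ∀ v, Rooted β f v) (hs : ∀ b, ∃ v, β v = some b) :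
    Function.Injective (blockEdge β f) := by
  intro b b' h
  by_contra hne
  obtain ⟨u, hu⟩ := hs b
  obtain ⟨u', hu'⟩ := hs b'
  have h1 : u = f b' := by
    rcases mem_blockEdge.mp (h ▸ mem_blockEdge.mpr (.inr hu)) with h1 | h1
    · exact h1
    · exact absurd (Option.some.inj (hu.symm.trans h1)) hne
  have h2 : u' = f b := by
    rcases mem_blockEdge.mp (h ▸ mem_blockEdge.mpr (.inr hu')) with h1 | h1
    · exact h1
    · exact absurd (Option.some.inj (h1.symm.trans hu')) hne
  exact (wellFounded_parent R).asymmetric _ _ ⟨b, hu, h2⟩ ⟨b', hu', h1⟩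

variable [Fintype B]

/-- Without the edge above `v`, only descendants of `v` can be reached from it. Another vertex of
that edge is the parent `f b` or a sibling; were it a descendant, `f b` would be one too, and `v`
its own proper ancestor. -/
theorem not_joined_erase_blockEdge (R : ∀ v, Rooted β f v) {b : B} {v w : V} (hv : β v = some b)
    (hw : w ∈ blockEdge β f b) (hvw : v ≠ w) :
    ¬ Joined ((univ.image (blockEdge β f)).erase (blockEdge β f b)) v w := by
  intro hj
  let P : V → V → Prop := fun u v => ∃ b, β v = some b ∧ u = f b
  have hD : Relation.ReflTransGen P v w := by
    clear hw hvw
    induction hj with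
    | refl => exact .refl
    | @tail a c _ h ih =>
      obtain ⟨e, he, ha, hc⟩ := h
      obtain ⟨hne, he⟩ := mem_erase.mp he
      obtain ⟨b', -, rfl⟩ := mem_image.mp he
      have hb : b' ≠ b := fun h => hne (h ▸ rfl)
      have hfb : Relation.ReflTransGen P v (f b') := by
        rcases mem_blockEdge.mp ha with ha | ha
        · exact ha ▸ ih
        · rcases Relation.ReflTransGen.cases_tail ih with rfl | ⟨x, hx, b'', hb'', rfl⟩
          · exact absurd (Option.some.inj (ha.symm.trans hv)) hb
          · obtain rfl : b'' = b' := Option.some.inj (hb''.symm.trans ha)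
            exact hx
      rcases mem_blockEdge.mp hc with hc | hc
      · exact hc ▸ hfb
      · exact hfb.tail ⟨b', hc, rfl⟩
  have hfb : Relation.ReflTransGen P v (f b) := by
    rcases mem_blockEdge.mp hw with hw | hw
    · exact hw ▸ hD
    · rcases Relation.ReflTransGen.cases_tail hD with h | ⟨c, hc, b'', hb'', rfl⟩
      · exact absurd h.symm hvw
      · obtain rfl : b'' = b := Option.some.inj (hb''.symm.trans hw)
        exact hc
  have hT : Relation.TransGen P v v := Relation.TransGen.tail' hfb ⟨b, hv, rfl⟩
  exact (wellFounded_parent R).transGen.irrefl.irrefl v hT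

/-- The hypertree whose edges are the blocks together with their parents. -/
def blockHypertree [Nonempty B] (hr : ∀ v, β v = none ↔ v = r)
    (hs : ∀ b, ∃ v, β v = some b) (R : ∀ v, Rooted β f v) : Hypertree V where
  edges := univ.image (blockEdge β f)
  isHypergraph := by
    refine ⟨univ_nonempty.image _, fun e he => ?_⟩
    obtain ⟨b, -, rfl⟩ := mem_image.mp he
    obtain ⟨v, hv⟩ := hs b
    refine one_lt_card.mpr ⟨f b, mem_blockEdge.mpr (.inl rfl), v, mem_blockEdge.mpr (.inr hv), ?_⟩
    rintro rfl
    exact (R (f b)).ne_some hv hv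
  connected := by
    have h : ∀ v, Joined (univ.image (blockEdge β f)) v r := by
      intro v
      induction R v with
      | root h => rw [(hr _).mp h]; exact .refl
      | @step v b h _ ih =>
        exact (Joined.of_mem (mem_image_of_mem _ (mem_univ b)) (mem_blockEdge.mpr (.inr h))
          (mem_blockEdge.mpr (.inl rfl))).trans ih
    exact fun v w => (h v).trans (h w).symm
  acyclic := by
    rw [hasCycle_iff]
    rintro ⟨e, he, v, hv, w, hw, hvw, hj⟩
    obtain ⟨b, -, rfl⟩ := mem_image.mp he
    rcases mem_blockEdge.mp hv with h | h
    · rcases mem_blockEdge.mp hw with h' | h'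
      · exact hvw (h.trans h'.symm)
      · exact not_joined_erase_blockEdge R h' hv hvw.symm hj.symm
    · exact not_joined_erase_blockEdge R h hw hvw hj

omit [Fintype B] in
-- The labelled edges determine blocks and parents, by induction away from the root.
theorem eq_of_blockEdge_eq {β' : V → Option B} {f' : B → V} (hr : ∀ v, β v = none ↔ v = r)
    (hr' : ∀ v, β' v = none ↔ v = r) (R : ∀ v, Rooted β f v)
    (h : blockEdge β f = blockEdge β' f') : β = β' ∧ f = f' := by
  have hmem : ∀ b v, (v = f b ∨ β v = some b) ↔ (v = f' b ∨ β' v = some b) := fun b v => by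
    rw [← mem_blockEdge, ← mem_blockEdge, h]
  have hβ : ∀ v, β v = β' v := by
    intro v
    induction R v with
    | root h => rw [h, (hr' _).mpr ((hr _).mp h)]
    | @step v b h _ ih =>
      have h1 : f b = f' b := by
        rcases (hmem b (f b)).mp (.inl rfl) with h1 | h1
        · exact h1
        · rw [← ih] at h1
          exact absurd h1 ((R _).ne_some h1)
      rcases (hmem b v).mp (.inr h) with h2 | h2
      · rw [h2, ← h1] at h
        exact absurd h ((R _).ne_some h)
      · rw [h, h2]
  refine ⟨funext hβ, funext fun b => ?_⟩
  rcases (hmem b (f b)).mp (.inl rfl) with h1 | h1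
  · exact h1
  · rw [← hβ] at h1
    exact absurd h1 ((R _).ne_some h1)

/-- The parent of `d b` is its vertex still joined to `r` after `d b` is removed: it exists by
connectedness and is unique by acyclicity. Every vertex other than `r` is then a non-parent in
exactly one edge. -/
theorem exists_parents (T : Hypertree V) (r : V) {d : B → Finset V}
    (hd : Function.Injective d) (hT : univ.image d = T.edges) :
    ∃ (β : V → Option B) (f : B → V), (∀ v, β v = none ↔ v = r) ∧ (∀ b, ∃ v, β v = some b) ∧
      (∀ v, Rooted β f v) ∧ blockEdge β f = d := by
  classical
  have hmem : ∀ b, d b ∈ T.edges := fun b => hT ▸ mem_image_of_mem _ (mem_univ b)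
  have hbridge : ∀ b, ∀ v ∈ d b, ∀ w ∈ d b, Joined (T.edges.erase (d b)) v w → v = w := by
    intro b v hv w hw hj
    by_contra hne
    exact T.acyclic (hasCycle_iff.mpr ⟨d b, hmem b, v, hv, w, hw, hne, hj⟩)
  have hf : ∀ b, ∃ u ∈ d b, Joined (T.edges.erase (d b)) r u := by
    intro b
    have h2 := T.isHypergraph.2 _ (hmem b)
    obtain ⟨w, hw⟩ := card_pos.mp (by omega : 0 < (d b).card)
    rcases (T.connected r w).erase_or (d b) with h | h
    · exact ⟨w, hw, h⟩
    · exact h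
  choose f hfd hfj using hf
  have huniq : ∀ b b' v, v ∈ d b → v ≠ f b → v ∈ d b' → v ≠ f b' → b = b' := by
    intro b b' v hb hvb hb' hvb'
    by_contra hne
    have hsub : (T.edges.erase (d b')).erase (d b) ⊆ T.edges.erase (d b) :=
      erase_subset_erase _ (erase_subset _ _)
    -- Take the path from `r` to `f b'`. If it avoids `d b`, continuing along `d b'` joins `r` to
    -- `v` without `d b`; if it meets `d b`, continuing along `d b` joins `r` to `v` without `d b'`.
    rcases (hfj b').erase_or (d b) with h | ⟨w, hw, h⟩
    · have h1 : Joined (T.edges.erase (d b)) (f b') v :=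
        .of_mem (mem_erase.mpr ⟨hd.ne (Ne.symm hne), hmem b'⟩) (hfd b') hb'
      exact hvb (hbridge b _ hb _ (hfd b) (((h.mono hsub).trans h1).symm.trans (hfj b)))
    · have h1 : Joined (T.edges.erase (d b')) w v :=
        .of_mem (mem_erase.mpr ⟨hd.ne hne, hmem b⟩) hw hb
      exact hvb' (hbridge b' _ hb' _ (hfd b')
        (((h.mono (erase_subset _ _)).trans h1).symm.trans (hfj b')))
  have hex : ∀ v, v ≠ r → ∃ b, v ∈ d b ∧ v ≠ f b := by
    intro v hv
    -- Follow a path from `r` until its first edge containing `v`.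
    have key : ∀ w, Joined T.edges r w →
        (w ≠ v ∧ Joined (T.edges.filter (v ∉ ·)) r w) ∨
        ∃ e ∈ T.edges, v ∈ e ∧ ∃ u ∈ e, u ≠ v ∧ Joined (T.edges.filter (v ∉ ·)) r u := by
      intro w hw
      induction hw with
      | refl => exact .inl ⟨hv.symm, .refl⟩
      | @tail a c _ h ih =>
        rcases ih with ⟨hav, ih⟩ | ih
        · obtain ⟨e, he, ha, hc⟩ := h
          by_cases hve : v ∈ e
          · exact .inr ⟨e, he, hve, a, ha, hav, ih⟩
          · refine .inl ⟨fun h => hve (h ▸ hc), ih.trans (.of_mem (mem_filter.mpr ⟨he, hve⟩) ha hc)⟩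
        · exact .inr ih
    rcases key v (T.connected r v) with ⟨h, -⟩ | ⟨e, he, hve, u, hu, huv, hj⟩
    · exact absurd rfl h
    · obtain ⟨b, -, rfl⟩ := mem_image.mp (hT ▸ he)
      refine ⟨b, hve, fun hvb => huv ?_⟩
      have hsub : T.edges.filter (v ∉ ·) ⊆ T.edges.erase (d b) := fun e he =>
        mem_erase.mpr ⟨fun h => (mem_filter.mp he).2 (h ▸ hve), (mem_filter.mp he).1⟩
      rw [hvb]
      exact hbridge b _ hu _ (hfd b) ((hj.mono hsub).symm.trans (hfj b))
  choose c hcd hcf using hex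
  let β : V → Option B := fun v => if h : v = r then none else some (c v h)
  have hβ : ∀ v b, β v = some b ↔ v ∈ d b ∧ v ≠ f b := by
    intro v b
    by_cases h : v = r
    · subst h
      simp only [β, dif_pos rfl, reduceCtorEq, false_iff, not_and, not_not]
      exact fun hv => hbridge b _ hv _ (hfd b) (hfj b)
    · simp only [β, dif_neg h, Option.some.injEq]
      refine ⟨fun hb => hb ▸ ⟨hcd v h, hcf v h⟩, fun hb => ?_⟩
      exact huniq _ _ v (hcd v h) (hcf v h) hb.1 hb.2
  refine ⟨β, f, fun v => ?_, fun b => ?_, ?_, ?_⟩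
  · by_cases h : v = r <;> simp [β, h]
  · obtain ⟨v, hv, hne⟩ := exists_mem_ne (T.isHypergraph.2 _ (hmem b)) (f b)
    exact ⟨v, (hβ v b).mpr ⟨hv, hne⟩⟩
  -- The number of edges separating a vertex from `r` decreases strictly on passing to the parent.
  · let S : V → Finset B := fun v => univ.filter fun b => ¬ Joined (T.edges.erase (d b)) r v
    intro v
    induction hn : (S v).card using Nat.strong_induction_on generalizing v with
    | _ n ih =>
      rcases h : β v with _ | b
      · exact .root h
      · refine .step h (ih _ ?_ _ rfl)
        obtain ⟨hvb, hvf⟩ := (hβ v b).mp h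
        rw [← hn]
        refine card_lt_card (ssubset_iff_of_subset ?_ |>.mpr ⟨b, ?_, ?_⟩)
        · intro b' hb'
          simp only [S, mem_filter, mem_univ, true_and] at hb' ⊢
          intro hj
          by_cases hbb : b' = b
          · subst hbb; exact hb' (hfj b')
          · exact hb' (hj.trans (.of_mem (mem_erase.mpr ⟨hd.ne (Ne.symm hbb), hmem b⟩) hvb (hfd b)))
        · simp only [S, mem_filter, mem_univ, true_and]
          exact fun hj => hvf (hbridge b _ hvb _ (hfd b) (hj.symm.trans (hfj b)))
        · simp only [S, mem_filter, mem_univ, true_and, not_not]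
          exact hfj b
  · funext b
    ext v
    rw [mem_blockEdge, hβ]
    by_cases h : v = f b
    · simp [h, hfd b]
    · simp [h]

end Parents

end HypertreeSeries

/-! ### Counting cyclic and flag-pointed hypertrees -/

namespace HypertreeSeries

open Finset

/-- The number of edges containing a vertex. -/
def Hypertree.degree {V : Type*} [DecidableEq V] (T : Hypertree V) (v : V) : ℕ :=
  (T.edges.filter fun e => v ∈ e).card

/-- A vertex lies in the edges of which it is the parent and, unless it is the root, in the edge of
its own block. -/
theorem degree_eq_of_blockEdge {V B : Type*} [Fintype V] [DecidableEq V] [DecidableEq B]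
    [Fintype B] {β : V → Option B} {f : B → V} {r : V} (hr : ∀ v, β v = none ↔ v = r)
    (R : ∀ v, Rooted β f v) (hs : ∀ b, ∃ v, β v = some b) (T : Hypertree V)
    (hT : univ.image (blockEdge β f) = T.edges) (v : V) :
    T.degree v = fiberCard f v + if v = r then 0 else 1 := by
  have h1 : T.degree v = (univ.filter fun b => v ∈ blockEdge β f b).card := by
    rw [Hypertree.degree, ← hT, filter_image, card_image_of_injective _ (blockEdge_injective R hs)]
  have h2 : (univ.filter fun b => v ∈ blockEdge β f b)
      = (univ.filter fun b => f b = v) ∪ univ.filter fun b => β v = some b := by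
    ext b
    simp [mem_blockEdge, eq_comm]
  rw [h1, h2, card_union_of_disjoint, fiberCard]
  · congr 1
    split_ifs with h
    · simp [(hr v).mpr h]
    · obtain ⟨b, hb⟩ := Option.ne_none_iff_exists'.mp (mt (hr v).mp h)
      simp [hb, filter_eq]
  · rw [disjoint_left]
    intro b hb hb'
    simp only [mem_filter, mem_univ, true_and] at hb hb'
    exact (R v).ne_some (hb.symm ▸ hb') hb'

theorem card_filter_injective_image_eq {α : Type*} [Fintype α] [DecidableEq α] (E : Finset α)
    (n : ℕ) : (univ.filter fun d : Fin n → α => Function.Injective d ∧ univ.image d = E).card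
      = if E.card = n then n.factorial else 0 := by
  split_ifs with h
  · rw [← Nat.descFactorial_self]
    have h1 : Fintype.card (Fin n ↪ E) = n.descFactorial n := by
      rw [Fintype.card_embedding_eq, Fintype.card_coe, h, Fintype.card_fin]
    rw [← h1, ← Fintype.card_coe]
    refine Fintype.card_congr
      { toFun := fun d => ⟨fun i => ⟨d.1 i, ?_⟩, fun i j hij => ?_⟩
        invFun := fun d => ⟨fun i => (d i).1, ?_⟩
        left_inv := fun d => rfl
        right_inv := fun d => rfl }
    · exact (mem_filter.mp d.2).2.2.subset (mem_image_of_mem _ (mem_univ i))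
    · exact (mem_filter.mp d.2).2.1 (by simpa using hij)
    · have hinj : Function.Injective fun i => (d i).1 :=
        Subtype.val_injective.comp d.injective
      refine mem_filter.mpr ⟨mem_univ _, hinj, eq_of_subset_of_card_le ?_ ?_⟩
      · intro x hx
        obtain ⟨i, -, rfl⟩ := mem_image.mp hx
        exact (d i).2
      · rw [card_image_of_injective _ hinj]
        simp [h]
  · rw [card_eq_zero, filter_eq_empty_iff]
    rintro d - ⟨hd, rfl⟩
    exact h (by simp [card_image_of_injective _ hd])

noncomputable instance {V : Type*} [Finite V] : Fintype (Hypertree V) := Fintype.ofFinite _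

/-- The block map of the partition of `{1, …, m}` into the fibres of `g`, with root `0`. -/
def rootedBlocks {m : ℕ} {B : Type*} (g : Fin m → B) : Fin (m + 1) → Option B :=
  Fin.cons none fun i => some (g i)

theorem rootedBlocks_eq_none {m : ℕ} {B : Type*} (g : Fin m → B) (v : Fin (m + 1)) :
    rootedBlocks g v = none ↔ v = 0 := by
  induction v using Fin.cases <;> simp [rootedBlocks]

theorem exists_rootedBlocks_eq_some {m : ℕ} {B : Type*} {g : Fin m → B}
    (hg : Function.Surjective g) (b : B) : ∃ v, rootedBlocks g v = some b := by
  obtain ⟨i, rfl⟩ := hg b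
  exact ⟨i.succ, by simp [rootedBlocks]⟩

open Classical in
/-- Hypertrees with a given number of edges, weighted by a function of their degrees. -/
theorem sum_hypertree_degree {K : Type*} [CommRing K] (m k : ℕ) (W : (Fin (m + 1) → ℕ) → K) :
    ((k + 1).factorial : K) * ∑ T : Hypertree (Fin (m + 1)) with T.edges.card = k + 1, W T.degree
      = surjCount m (k + 1) * ∑ h : Fin k → Fin (m + 1), W fun v => fiberCard h v + 1 := by
  have h1 : ((k + 1).factorial : K) *
        ∑ T : Hypertree (Fin (m + 1)) with T.edges.card = k + 1, W T.degree
      = ∑ p : Hypertree (Fin (m + 1)) × (Fin (k + 1) → Finset (Fin (m + 1)))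
          with Function.Injective p.2 ∧ univ.image p.2 = p.1.edges, W p.1.degree := by
    rw [sum_filter, sum_filter, Fintype.sum_prod_type, mul_sum]
    refine sum_congr rfl fun T _ => ?_
    rw [← sum_filter]
    change _ = ∑ d : Fin (k + 1) → Finset (Fin (m + 1))
      with Function.Injective d ∧ univ.image d = T.edges, W T.degree
    rw [sum_const]
    have := card_filter_injective_image_eq T.edges (k + 1)
    simp only [nsmul_eq_mul]
    convert_to _ = (((if T.edges.card = k + 1 then (k + 1).factorial else 0 : ℕ) : K)) * _
    · rw [← this]
    · split_ifs <;> simp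
  have h2 : (surjCount m (k + 1) : K) * ∑ h : Fin k → Fin (m + 1), W (fun v => fiberCard h v + 1)
      = ∑ p : (Fin m → Fin (k + 1)) × (Fin (k + 1) → Fin (m + 1))
          with Function.Surjective p.1 ∧ ∀ v, Rooted (rootedBlocks p.1) p.2 v,
          W fun v => fiberCard p.2 v + if v = 0 then 0 else 1 := by
    rw [sum_filter, Fintype.sum_prod_type, surjCount, Fintype.card_subtype, ← nsmul_eq_mul,
      ← sum_const, sum_filter]
    refine Eq.trans (sum_congr (by ext; simp) fun g _ => ?_) rfl
    by_cases hg : Function.Surjective g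
    · have := sum_rooted_fiberCard (fun c => W fun v => c v + if v = 0 then 0 else 1)
        (rootedBlocks g) (k := k) (by simp) (rootedBlocks_eq_none g)
      simp only [hg, true_and, if_true]
      rw [← sum_filter]
      refine Eq.trans ?_ (this.symm.trans ?_)
      · refine sum_congr rfl fun h _ => ?_
        congr 1
        funext v
        by_cases hv : v = 0 <;> simp [hv] <;> congr!
      · congr!
    · simp [hg]
  rw [h1, h2]
  symm
  -- Pairs (surjection, rooted parent map) correspond to hypertrees with labelled edges.
  refine sum_bij (fun p hp => (blockHypertree (rootedBlocks_eq_none p.1)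
    (exists_rootedBlocks_eq_some (mem_filter.mp hp).2.1) (mem_filter.mp hp).2.2,
      blockEdge (rootedBlocks p.1) p.2)) ?_ ?_ ?_ ?_
  · intro p hp
    obtain ⟨-, hg, R⟩ := mem_filter.mp hp
    exact mem_filter.mpr ⟨mem_univ _,
      blockEdge_injective R (exists_rootedBlocks_eq_some hg), by simp [blockHypertree]⟩
  · rintro ⟨g, f⟩ hp ⟨g', f'⟩ hp' h
    obtain ⟨-, hg, R⟩ := mem_filter.mp hp
    obtain ⟨h3, rfl⟩ := eq_of_blockEdge_eq (rootedBlocks_eq_none g) (rootedBlocks_eq_none g') R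
      (congrArg Prod.snd h)
    congr 1
    funext i
    have := congrFun h3 i.succ
    simpa [rootedBlocks] using this
  · rintro ⟨T, d⟩ hp
    obtain ⟨-, hd, hT⟩ := mem_filter.mp hp
    obtain ⟨β, f, hr, hs, R, hdf⟩ := exists_parents T 0 hd (by rw [← hT])
    have hsome : ∀ i : Fin m, (β i.succ).isSome := fun i =>
      Option.isSome_iff_ne_none.mpr (mt (hr _).mp (Fin.succ_ne_zero i))
    have hβ : β = rootedBlocks fun i => (β i.succ).get (hsome i) := by
      funext v
      induction v using Fin.cases with
      | zero => simp [rootedBlocks, hr]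
      | succ i => simp [rootedBlocks]
    have hg : Function.Surjective fun i => (β i.succ).get (hsome i) := by
      intro b
      obtain ⟨v, hv⟩ := hs b
      induction v using Fin.cases with
      | zero => rw [(hr 0).mpr rfl] at hv; cases hv
      | succ i => exact ⟨i, by simp [hv]⟩
    refine ⟨(fun i => (β i.succ).get (hsome i), f), mem_filter.mpr ⟨mem_univ _, hg, hβ ▸ R⟩, ?_⟩
    have hd' : blockEdge (rootedBlocks fun i => (β i.succ).get (hsome i)) f = d := by
      rw [← hβ]; exact hdf
    refine Prod.ext ?_ hd'
    have hedges : ∀ T T' : Hypertree (Fin (m + 1)), T.edges = T'.edges → T = T' := by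
      rintro ⟨⟩ ⟨⟩ h; cases h; rfl
    apply hedges
    rw [← hT, ← hd']
    simp only [blockHypertree]
  · intro p hp
    obtain ⟨-, hg, R⟩ := mem_filter.mp hp
    congr 1
    funext v
    rw [degree_eq_of_blockEdge (rootedBlocks_eq_none p.1) R (exists_rootedBlocks_eq_some hg) _ rfl]

/-- A set with `n` elements has `(n - 1)!` cyclic orders. -/
theorem card_cyclicOrder (α : Type*) [Finite α] :
    Nat.card (CyclicOrder α) = (Nat.card α - 1).factorial := by
  classical
  have := Fintype.ofFinite α
  rcases subsingleton_or_nontrivial α with h | h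
  -- Truncated subtraction covers the empty set as well: one cyclic order, the identity.
  · have h1 : Nat.card α - 1 = 0 := Nat.sub_eq_zero_of_le (Finite.card_le_one_iff_subsingleton.mpr h)
    rw [h1, Nat.factorial_zero, Nat.card_eq_one_iff_unique]
    exact ⟨inferInstance, ⟨1, Equiv.Perm.isCycleOn_of_subsingleton _ _⟩⟩
  · have hc : 2 ≤ Fintype.card α := Fintype.one_lt_card
    have h1 := Equiv.Perm.card_of_cycleType_singleton (α := α) hc le_rfl
    rw [Nat.choose_self, mul_one] at h1
    rw [Nat.card_eq_fintype_card, Nat.card_eq_fintype_card, ← h1, Fintype.card_subtype]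
    congr 1
    refine filter_congr fun σ _ => ?_
    constructor
    · intro hσ
      have hsupp : σ.support = univ := by
        ext a
        simpa using hσ.apply_ne Set.nontrivial_univ (Set.mem_univ a)
      have hcyc : σ.IsCycle := by
        rw [Equiv.Perm.isCycle_iff_exists_isCycleOn]
        exact ⟨Set.univ, Set.nontrivial_univ, hσ, fun _ _ => Set.mem_univ _⟩
      rw [hcyc.cycleType, hsupp, card_univ]
    · intro hσ
      have hcyc : σ.IsCycle := by
        rw [← Equiv.Perm.card_cycleType_eq_one, hσ, Multiset.card_singleton]
      have hsupp : σ.support = univ := by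
        rw [← card_eq_iff_eq_univ, ← Equiv.Perm.sum_cycleType, hσ, Multiset.sum_singleton]
      have : {a | σ a ≠ a} = Set.univ := by
        ext a
        have : a ∈ σ.support := by rw [hsupp]; exact mem_univ a
        simpa using this
      exact this ▸ hcyc.isCycleOn

theorem card_edgesAt {V : Type*} [DecidableEq V] (T : Hypertree V) (v : V) :
    Nat.card (T.EdgesAt v) = T.degree v := by
  rw [Hypertree.degree, Nat.subtype_card]
  simp

theorem sum_sigma_fst {K : Type*} [CommRing K] {α : Type*} {β : α → Type*} [Fintype α]
    [∀ a, Finite (β a)] [Fintype (Σ a, β a)] (F : α → K) :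
    ∑ x : (Σ a, β a), F x.1 = ∑ a, (Nat.card (β a) : K) * F a := by
  have : ∀ a, Fintype (β a) := fun a => Fintype.ofFinite _
  have h := Fintype.sum_sigma (fun x : (Σ a, β a) => F x.1)
  have h1 : ∑ x : (Σ a, β a), F x.1 = ∑ a, ∑ _ : β a, F a := by
    rw [← h]
    exact sum_congr (by ext; simp) fun _ _ => rfl
  rw [h1]
  simp

/-- Cyclic hypertrees with `k + 1` edges, up to the labelling of the edges. -/
theorem factorial_mul_sum_hypertree {K : Type*} [CommRing K] (m k : ℕ) :
    ((k + 1).factorial : K) * ∑ T : Hypertree (Fin (m + 1)) with T.edges.card = k + 1,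
        ((∏ v, (T.degree v - 1).factorial : ℕ) : K)
      = surjCount m (k + 1) * ((m + 1).ascFactorial k : ℕ) := by
  have := sum_hypertree_degree (K := K) m k fun c => ((∏ v, (c v - 1).factorial : ℕ) : K)
  simp only [Nat.add_sub_cancel] at this
  simp only [← Nat.cast_sum] at this ⊢
  rwa [sum_prod_factorial_fiberCard, Fintype.card_fin] at this

/-- Flag-pointed cyclic hypertrees with `k + 1` edges, up to the labelling of the edges. -/
theorem factorial_mul_sum_hypertree_flags {K : Type*} [CommRing K] (m k : ℕ) :
    ((k + 1).factorial : K) * ∑ T : Hypertree (Fin (m + 1)) with T.edges.card = k + 1,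
        (((∏ v, (T.degree v - 1).factorial) * ∑ v, T.degree v : ℕ) : K)
      = surjCount m (k + 1) * ((m + 1).ascFactorial (k + 1) : ℕ) := by
  have := sum_hypertree_degree (K := K) m k fun c =>
    (((∏ v, (c v - 1).factorial) * ∑ v, c v : ℕ) : K)
  simp only [Nat.add_sub_cancel] at this
  -- The number of flags does not depend on `h`; it is the next factor of the rising factorial.
  have h1 : ∀ h : Fin k → Fin (m + 1), ∑ v, (fiberCard h v + 1) = m + 1 + k := by
    intro h
    have : ∑ v, fiberCard h v = k := by
      simpa [fiberCard] using (card_eq_sum_card_fiberwise (f := h) (s := univ) (t := univ)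
        (fun _ _ => mem_univ _)).symm
    rw [sum_add_distrib, this]
    simp [add_comm]
  simp only [h1] at this
  simp only [← Nat.cast_sum, ← sum_mul] at this ⊢
  rw [sum_prod_factorial_fiberCard, Fintype.card_fin] at this
  rw [this, Nat.ascFactorial_succ, mul_comm (m + 1 + k)]

theorem card_cyclicOrders {V : Type*} [Fintype V] [DecidableEq V] (T : Hypertree V) :
    Nat.card ((v : V) → CyclicOrder (T.EdgesAt v)) = ∏ v, (T.degree v - 1).factorial := by
  rw [Nat.card_pi]
  exact prod_congr rfl fun v _ => by rw [card_cyclicOrder, card_edgesAt]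

theorem card_flags {V : Type*} [Fintype V] [DecidableEq V] (T : Hypertree V) :
    Nat.card ((v : V) × T.EdgesAt v) = ∑ v, T.degree v := by
  rw [Nat.card_sigma]
  exact sum_congr rfl fun v _ => card_edgesAt T v

/-- Sorting hypertrees by their number of edges. -/
theorem sum_hypertree_eq_sum_range {K : Type*} [Field K] (n : ℕ) (t : K)
    (F : Hypertree (Fin n) → K) {N : ℕ} (hN : 2 ^ n ≤ N) :
    ∑ T, F T * t ^ T.rank
      = ∑ k ∈ range N, t ^ k * ∑ T : Hypertree (Fin n) with T.edges.card = k + 1, F T := by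
  have hpos : ∀ T : Hypertree (Fin n), T.edges.card = T.rank + 1 := fun T =>
    (Nat.sub_add_cancel (card_pos.mpr T.isHypergraph.1)).symm
  have hlt : ∀ T : Hypertree (Fin n), T.rank < N := fun T => by
    have h1 := T.edges.card_le_univ
    have h2 := hpos T
    simp at h1
    omega
  rw [← sum_fiberwise_of_maps_to (g := Hypertree.rank) (t := range N)
    (fun T _ => mem_range.mpr (hlt T))]
  refine sum_congr rfl fun k _ => ?_
  rw [mul_sum]
  refine sum_congr (filter_congr fun T _ => ?_) fun T hT => ?_
  · rw [hpos]; omega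
  · rw [mem_filter, hpos] at hT
    rw [Nat.succ_injective hT.2, mul_comm]

section Coefficients

variable {K : Type*} [Field K] [CharZero K]

theorem coeff_HAC (t : K) (m : ℕ) {N : ℕ} (hN : 2 ^ (m + 1) ≤ N) :
    PowerSeries.coeff (m + 1) (HAC t) * ((m + 1).factorial : K)
      = ∑ k ∈ range N, t ^ k *
        (surjCount m (k + 1) * ((m + 1).ascFactorial k : ℕ) / ((k + 1).factorial : K)) := by
  have h0 : ((m + 1).factorial : K) ≠ 0 := Nat.cast_ne_zero.mpr (Nat.factorial_ne_zero _)
  rw [HAC, PowerSeries.coeff_mk, div_mul_cancel₀ _ h0,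
    sum_sigma_fst (fun T : Hypertree (Fin (m + 1)) => t ^ T.rank)]
  simp only [card_cyclicOrders]
  rw [sum_hypertree_eq_sum_range _ _ _ hN]
  refine sum_congr rfl fun k _ => ?_
  rw [← factorial_mul_sum_hypertree, mul_div_cancel_left₀]
  exact Nat.cast_ne_zero.mpr (Nat.factorial_ne_zero _)

theorem coeff_HACpa (t : K) (m : ℕ) {N : ℕ} (hN : 2 ^ (m + 1) ≤ N) :
    PowerSeries.coeff (m + 1) (HACpa t) * ((m + 1).factorial : K)
      = ∑ k ∈ range N, t ^ k *
        (surjCount m (k + 1) * ((m + 1).ascFactorial (k + 1) : ℕ) / ((k + 1).factorial : K)) := by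
  have h0 : ((m + 1).factorial : K) ≠ 0 := Nat.cast_ne_zero.mpr (Nat.factorial_ne_zero _)
  rw [HACpa, PowerSeries.coeff_mk, div_mul_cancel₀ _ h0,
    sum_sigma_fst (fun H : CyclicHypertree (Fin (m + 1)) => t ^ H.1.rank)]
  simp only [card_flags]
  rw [sum_sigma_fst (fun T : Hypertree (Fin (m + 1)) =>
    ((∑ v, T.degree v : ℕ) : K) * t ^ T.rank)]
  simp only [card_cyclicOrders, ← mul_assoc]
  simp only [← Nat.cast_mul (∏ v, _)]
  rw [sum_hypertree_eq_sum_range _ _ _ hN]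
  refine sum_congr rfl fun k _ => ?_
  rw [← factorial_mul_sum_hypertree_flags, mul_div_cancel_left₀]
  exact Nat.cast_ne_zero.mpr (Nat.factorial_ne_zero _)

omit [CharZero K] in
theorem coeff_zero_HACpa (t : K) : PowerSeries.coeff 0 (HACpa t) = 0 := by
  have : IsEmpty (FlagPointedCyclicHypertree (Fin 0)) := ⟨fun F => F.2.1.elim0⟩
  simp [HACpa]

end Coefficients

end HypertreeSeries

/-! ### Solving the system -/

namespace HypertreeSeries

open Finset PowerSeries

variable {K : Type*} [Field K] [CharZero K]

/-- The series `1 - t (exp X - 1)`, of which the substitution of `z` is `B / z`. -/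
noncomputable def quotientSeries (t : K) : K⟦X⟧ := 1 - t • (exp K - 1)

theorem constantCoeff_quotientSeries (t : K) : constantCoeff (quotientSeries t) = 1 := by
  simp [quotientSeries]

theorem inv_mul_quotientSeries (t : K) : (quotientSeries t)⁻¹ * quotientSeries t = 1 :=
  PowerSeries.inv_mul_cancel _ (by simp [constantCoeff_quotientSeries])

theorem subst_quotientSeries (t : K) {z : K⟦X⟧} (hz : constantCoeff z = 0) :
    (quotientSeries t).subst z = 1 - t • ((exp K).subst z - 1) := by
  have hz' := HasSubst.of_constantCoeff_zero' hz
  have hone : subst z (1 : K⟦X⟧) = 1 := by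
    simpa using subst_coe (R := K) (S := K) hz' (1 : Polynomial K)
  rw [quotientSeries, subst_sub hz', subst_smul hz', subst_sub hz', hone]

/-- Binomial expansion in `t (exp X - 1)`. Terms beyond `n` vanish, so `N` is left free to match the
range `2 ^ (m + 1)` of the hypertree sums. -/
theorem coeff_inv_quotientSeries_pow (t : K) (d n N : ℕ) (hN : n ≤ N) :
    coeff n ((quotientSeries t)⁻¹ ^ (d + 1)) = (if n = 0 then 1 else 0) +
      ∑ k ∈ range N, ((d + (k + 1)).choose d : K) *
        (t ^ (k + 1) * ((surjCount n (k + 1) : K) / n.factorial)) := by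
  have h0 : (n.factorial : K) ≠ 0 := Nat.cast_ne_zero.mpr (Nat.factorial_ne_zero _)
  rw [coeff_pow_of_mul_one_sub_eq_one (u := t • (exp K - 1)) (by simp) (inv_mul_quotientSeries t) d
    (Nat.lt_succ_of_le hN), sum_range_succ', add_comm]
  congr 1
  · simp [coeff_one]
  · refine sum_congr rfl fun k _ => ?_
    rw [surjCount_eq_coeff, mul_div_cancel_left₀ _ h0, smul_pow, coeff_smul, smul_eq_mul]

/-- The compositional inverse of `z ↦ z - t z (exp z - 1)`. -/
theorem subst_eq_X_iff (t : K) {z : K⟦X⟧} (hz : constantCoeff z = 0) :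
    X = z - t • (z * ((exp K).subst z - 1)) ↔ (X * quotientSeries t).subst z = X := by
  have hz' := HasSubst.of_constantCoeff_zero' hz
  have h1 : z - t • (z * ((exp K).subst z - 1)) = z * (1 - t • ((exp K).subst z - 1)) := by
    rw [mul_sub z 1, mul_one, mul_smul_comm]
  rw [subst_mul hz', subst_X hz', subst_quotientSeries t hz, h1, eq_comm]

theorem exists_subst_eq_X (t : K) : ∃ z : K⟦X⟧, constantCoeff z = 0 ∧
    (X * quotientSeries t).subst z = X := by
  have h1 : IsUnit (coeff 1 (X * quotientSeries t)) := by
    rw [show (1 : ℕ) = 0 + 1 from rfl, coeff_succ_X_mul]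
    simp [constantCoeff_quotientSeries]
  exact ⟨_, constantCoeff_substInvOfIsUnit _ h1, subst_substInvOfIsUnit_right _ (by simp) h1⟩

/-- The right inverse `z` is also a left inverse, so Lagrange inversion applies to `H.subst z`,
whose composite with `X * q` is `H`. -/
theorem coeff_succ_subst_of_subst_eq_X {t : K} {z : K⟦X⟧} (hz : constantCoeff z = 0)
    (h : (X * quotientSeries t).subst z = X) (H : K⟦X⟧) (n : ℕ) :
    (n + 1 : K) * coeff (n + 1) (H.subst z)
      = coeff n (derivative K H * (quotientSeries t)⁻¹ ^ (n + 1)) := by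
  set g := X * quotientSeries t with hg
  have hg0 : constantCoeff g = 0 := by simp [hg]
  have hg' := HasSubst.of_constantCoeff_zero' hg0
  have hz' := HasSubst.of_constantCoeff_zero' hz
  have h1 : IsUnit (coeff 1 g) := by
    rw [hg, show (1 : ℕ) = 0 + 1 from rfl, coeff_succ_X_mul]
    simp [constantCoeff_quotientSeries]
  have hleft := subst_substInvOfIsUnit_left g hg0 h1
  have hzg : z.subst g = X := by
    have h2 := congrArg (subst z) hleft
    rw [subst_comp_subst_apply hg' hz', h, X_subst, subst_X hz'] at h2
    rw [← h2, hleft]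
  rw [lagrange_inversion (inv_mul_quotientSeries t) (constantCoeff_quotientSeries t), ← hg,
    subst_comp_subst_apply hz' hg', hzg, X_subst]

theorem eq_X_add_HACpa {t : K} {z : K⟦X⟧} (hz : constantCoeff z = 0)
    (h : (X * quotientSeries t).subst z = X) : z = X + t • HACpa t := by
  ext n
  cases n with
  | zero => simpa [hz] using Or.inr (coeff_zero_HACpa t)
  | succ m =>
    have hm : (m + 1 : K) ≠ 0 := Nat.cast_add_one_ne_zero m
    have h0 : (m.factorial : K) ≠ 0 := Nat.cast_ne_zero.mpr (Nat.factorial_ne_zero _)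
    have h1 := coeff_succ_subst_of_subst_eq_X hz h X m
    have hN : m ≤ 2 ^ (m + 1) := ((Nat.lt_two_pow_self (n := m)).le.trans
      (Nat.pow_le_pow_right two_pos m.le_succ))
    rw [subst_X (HasSubst.of_constantCoeff_zero' hz), derivative_X, one_mul,
      coeff_inv_quotientSeries_pow t m m _ hN] at h1
    have h2 := coeff_HACpa t m le_rfl
    -- The binomial is the rising factorial `(m + 1) ⋯ (m + k + 1)` over `(k + 1)!`.
    have h3 : ∀ k : ℕ, ((m + (k + 1)).choose m : K) *
        (t ^ (k + 1) * ((surjCount m (k + 1) : K) / m.factorial))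
        = t * (t ^ k * (surjCount m (k + 1) * ((m + 1).ascFactorial (k + 1) : ℕ) /
          ((k + 1).factorial : K))) / m.factorial := by
      intro k
      have h4 : ((k + 1).factorial : K) ≠ 0 := Nat.cast_ne_zero.mpr (Nat.factorial_ne_zero _)
      rw [Nat.ascFactorial_eq_factorial_mul_choose, Nat.choose_symm_add, Nat.cast_mul]
      field_simp
      ring
    rw [sum_congr rfl fun k _ => h3 k, ← sum_div, ← mul_sum, ← h2, Nat.factorial_succ,
      Nat.cast_mul, Nat.cast_succ] at h1
    rw [map_add, coeff_smul, smul_eq_mul, coeff_X]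
    apply mul_left_cancel₀ hm
    rw [h1]
    by_cases hm0 : m = 0
    · subst hm0; simp
    · simp [hm0]; field_simp

/-- Makes the Lagrange coefficient of `log q` a coefficient of a derivative of a power of `q⁻¹`, one
degree higher. -/
theorem derivative_logOf_quotientSeries_mul (t : K) (n : ℕ) :
    derivative K (logOf (quotientSeries t)) * (quotientSeries t)⁻¹ ^ (n + 1) * (n + 1 : ℕ)
      = - derivative K ((quotientSeries t)⁻¹ ^ (n + 1)) := by
  have h1 := derivative_logOf_mul (constantCoeff_quotientSeries t)
  have h2 := inv_mul_quotientSeries t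
  rw [Derivation.leibniz_pow, derivative_inv', ← h1]
  simp only [smul_eq_mul, nsmul_eq_mul, Nat.add_sub_cancel]
  generalize derivative K (logOf (quotientSeries t)) = D at *
  linear_combination (-((n + 1 : ℕ) : K⟦X⟧) * D * (quotientSeries t)⁻¹ ^ (n + 1)) * h2

theorem logOf_eq_derivative_HAC {t : K} (ht : t ≠ 0) {z : K⟦X⟧} (hz : constantCoeff z = 0)
    (h : (X * quotientSeries t).subst z = X) :
    -(1 / t) • logOf ((quotientSeries t).subst z) = derivative K (HAC t) := by
  have hz' := HasSubst.of_constantCoeff_zero' hz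
  rw [← subst_logOf (constantCoeff_quotientSeries t) hz]
  ext n
  rw [coeff_derivative, coeff_smul, smul_eq_mul]
  cases n with
  | zero =>
    have h1 := coeff_HAC t 0 le_rfl
    rw [sum_eq_zero fun k _ => by rw [surjCount_eq_zero_of_lt (Nat.succ_pos k)]; simp] at h1
    have h2 : constantCoeff ((logOf (quotientSeries t)).subst z) = 0 :=
      constantCoeff_subst_eq_zero hz _ (constantCoeff_logOf (constantCoeff_quotientSeries t))
    simp at h1
    simp [h1, h2]
  | succ m =>
    have hm : (m + 1 : K) ≠ 0 := Nat.cast_add_one_ne_zero m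
    have hm2 : ((m + 1 : ℕ) + 1 : K) ≠ 0 := Nat.cast_add_one_ne_zero (m + 1)
    have h0 : ((m + 1).factorial : K) ≠ 0 := Nat.cast_ne_zero.mpr (Nat.factorial_ne_zero _)
    have h1 := coeff_succ_subst_of_subst_eq_X hz h (logOf (quotientSeries t)) m
    have h2 := congrArg (coeff m) (derivative_logOf_quotientSeries_mul t m)
    rw [mul_comm _ ((m + 1 : ℕ) : K⟦X⟧), ← map_natCast (C (R := K)), coeff_C_mul, ← h1, map_neg,
      coeff_derivative] at h2
    have hN : m + 1 ≤ 2 ^ (m + 1 + 1) := ((Nat.lt_two_pow_self (n := m + 1)).le.trans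
      (Nat.pow_le_pow_right two_pos (m + 1).le_succ))
    rw [coeff_inv_quotientSeries_pow t m (m + 1) _ hN, if_neg (Nat.succ_ne_zero m), zero_add] at h2
    have h5 := coeff_HAC t (m + 1) le_rfl
    have h3 : ∀ k : ℕ, ((m + (k + 1)).choose m : K) *
        (t ^ (k + 1) * ((surjCount (m + 1) (k + 1) : K) / (m + 1).factorial))
        = (t * (m + 1)) * (t ^ k * (surjCount (m + 1) (k + 1) *
          ((m + 1 + 1).ascFactorial k : ℕ) / ((k + 1).factorial : K))) / (m + 1).factorial := by
      intro k
      have h4 : ((k + 1).factorial : K) ≠ 0 := Nat.cast_ne_zero.mpr (Nat.factorial_ne_zero _)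
      -- The factor `m + 1` from differentiation completes the rising factorial.
      have h6 : ((m + 1 : ℕ) : K) * ((m + 1 + 1).ascFactorial k : ℕ)
          = (k + 1).factorial * ((m + (k + 1)).choose m : ℕ) := by
        rw [← Nat.cast_mul, ← Nat.cast_mul, Nat.succ_ascFactorial, ← Nat.ascFactorial_succ,
          Nat.ascFactorial_eq_factorial_mul_choose, Nat.choose_symm_add]
      rw [Nat.cast_succ] at h6
      field_simp
      linear_combination (-(t ^ (k + 1)) * (surjCount (m + 1) (k + 1) : K)) * h6
    rw [sum_congr rfl fun k _ => h3 k, ← sum_div, ← mul_sum, ← h5, Nat.factorial_succ (m + 1),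
      Nat.cast_mul, Nat.cast_succ (m + 1)] at h2
    push_cast at h2 hm2 ⊢
    field_simp at h2 ⊢
    linear_combination (-1 : K) * h2

end HypertreeSeries

open HypertreeSeries in
theorem mainTheorem3 {K : Type*} [Field K] [CharZero K] (t : K) (ht : t ≠ 0) (A z : PowerSeries K) :
    HypertreeSeries.IsSolution t A z ↔
      (A = PowerSeries.derivative K (HypertreeSeries.HAC t) ∧
        z = PowerSeries.X + t • HypertreeSeries.HACpa t) := by
  constructor
  · rintro ⟨hz, ⟨q, hq, -, rfl⟩, hB⟩
    rw [subst_eq_X_iff t hz] at hB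
    refine ⟨?_, eq_X_add_HACpa hz hB⟩
    have hz' := PowerSeries.HasSubst.of_constantCoeff_zero' hz
    have hz0 : z ≠ 0 := by
      rintro rfl
      exact PowerSeries.X_ne_zero (by rw [← hq, mul_zero])
    have h1 := hB
    rw [PowerSeries.subst_mul hz', PowerSeries.subst_X hz', mul_comm, ← hq] at h1
    rw [← mul_right_cancel₀ hz0 h1, logOf_eq_derivative_HAC ht hz hB]
  -- The counting series is not checked directly: some inverse `w` exists, and the uniqueness
  -- argument identifies it with that series.
  · obtain ⟨w, hw, hB⟩ := exists_subst_eq_X t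
    rintro ⟨rfl, rfl⟩
    rw [← eq_X_add_HACpa hw hB]
    have hw' := PowerSeries.HasSubst.of_constantCoeff_zero' hw
    refine ⟨hw, ⟨(quotientSeries t).subst w, ?_, ?_, (logOf_eq_derivative_HAC ht hw hB).symm⟩,
      (subst_eq_X_iff t hw).mpr hB⟩
    · rwa [PowerSeries.subst_mul hw', PowerSeries.subst_X hw', mul_comm] at hB
    · have : PowerSeries.constantCoeff ((PowerSeries.exp K).subst w - 1) = 0 := by
        have hone : PowerSeries.subst w (1 : K⟦X⟧) = 1 := by
          simpa using PowerSeries.subst_coe (R := K) (S := K) hw' (1 : Polynomial K)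
        rw [← hone, ← PowerSeries.subst_sub hw']
        exact PowerSeries.constantCoeff_subst_eq_zero hw _ (by simp)
      rw [subst_quotientSeries t hw, map_sub, map_one, PowerSeries.constantCoeff_smul, this]
      simp
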